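/- Work in max algebra: nonnegative reals $\mathbb{R}_+$ with addition $a\oplus b=\max(a,b)$ and the usual multiplication, extended to matrices and vectors in the usual way; all matrix products and powers below are max-algebraic, $(AB)_{ij}=\max_k a_{ik}b_{kj}$. Let $A=(a_{ij})\in\mathbb{R}_+^{n\times n}$. An eigenvalue of $A$ is an $\alpha\in\mathbb{R}_+$ with $Av=\alpha v$ for some $v\in\mathbb{R}_+^n$, $v\neq 0$; write $V(A,\alpha)=\{v\in\mathbb{R}_+^n : Av=\alpha v\}$ and let $\lambda(A)$ be the largest eigenvalue of $A$. A projector on a set $K\subseteq\mathbb{R}_+^n$ is a matrix $Q\in\mathbb{R}_+^{n\times n}$ with $Q^2=Q$ and $\{Qx : x\in\mathbb{R}_+^n\}=K$; a spectral projector on $V(A,1)$ is a projector on $V(A,1)$ that commutes with $A$. Let $A^*=I\oplus A\oplus A^2\oplus\cdots$ (entrywise supremum), with $i$-th column $A^*_{\cdot i}$ and $i$-th row $A^*_{i\cdot}$, and let $N_c$ be the set of critical nodes of $A$: the indices lying on a cycle $i_1\to i_2\to\cdots\to i_k\to i_1$ ($1\le k\le n$) with $a_{i_1i_2},\dots,a_{i_ki_1}>0$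 whose geometric mean $(a_{i_1i_2}\cdots a_{i_ki_1})^{1/k}$ is the largest among the geometric means of all closed sequences of length at most $n$. **Proposition.** Let $A\in\mathbb{R}_+^{n\times n}$ with $\lambda(A)=1$. Then the powers $A^m$, $m\ge 0$, are entrywise bounded (so that $A^*$ and $\bigoplus_{m\ge p}A^m$ are finite), there is a unique spectral projector $Q$ on $V(A,1)$, and $$Q=\bigoplus_{i\in N_c}A^*_{\cdot i}A^*_{i\cdot}=\lim_{p\to\infty}\bigoplus_{m\ge p}A^m .$$ -/

import Mathlib

open Filter Topology
open scoped NNReal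

namespace MaxAlg

noncomputable section

/-- The max-algebra product: `(A ⊗ B) i j = max_k (a_{ik} b_{kj})`. -/
def mul {n : ℕ} (A B : Matrix (Fin n) (Fin n) ℝ≥0) : Matrix (Fin n) (Fin n) ℝ≥0 :=
  fun i j => Finset.univ.sup fun k => A i k * B k j

/-- The max-algebra action on vectors: `(A ⊗ v) i = max_k (a_{ik} v_k)`. -/
def mulVec {n : ℕ} (A : Matrix (Fin n) (Fin n) ℝ≥0) (v : Fin n → ℝ≥0) : Fin n → ℝ≥0 :=
  fun i => Finset.univ.sup fun k => A i k * v k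

/-- Max-algebra powers of a square matrix, with `A ^ 0 = I`. -/
def pow {n : ℕ} (A : Matrix (Fin n) (Fin n) ℝ≥0) : ℕ → Matrix (Fin n) (Fin n) ℝ≥0
  | 0 => 1
  | m + 1 => mul (pow A m) A

/-- `V(A, α) = {v | A ⊗ v = α v}`. -/
def eigencone {n : ℕ} (A : Matrix (Fin n) (Fin n) ℝ≥0) (α : ℝ≥0) : Set (Fin n → ℝ≥0) :=
  {v | mulVec A v = α • v}

/-- The set of max-algebra eigenvalues. -/
def spectrum {n : ℕ} (A : Matrix (Fin n) (Fin n) ℝ≥0) : Set ℝ≥0 :=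
  {α | ∃ v ∈ eigencone A α, v ≠ 0}

/-- `r` is the Perron root `λ(A)`, that is, the largest eigenvalue of `A`. -/
def IsPerronRoot {n : ℕ} (A : Matrix (Fin n) (Fin n) ℝ≥0) (r : ℝ≥0) : Prop :=
  IsGreatest (spectrum A) r

/-- The geometric mean of the entries along the closed sequence `c 0, c 1, …, c k, c 0`
of length `k + 1` (addition in `Fin (k + 1)` is cyclic). -/
def cycleMean {n k : ℕ} (A : Matrix (Fin n) (Fin n) ℝ≥0) (c : Fin (k + 1) → Fin n) : ℝ≥0 :=
  (∏ j, A (c j) (c (j + 1))) ^ (1 / ((k : ℝ) + 1))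

/-- The maximal cycle geometric mean, over closed sequences of length `1, …, n`. -/
def maxCycleMean {n : ℕ} (A : Matrix (Fin n) (Fin n) ℝ≥0) : ℝ≥0 :=
  (Finset.range n).sup fun k =>
    (Finset.univ : Finset (Fin (k + 1) → Fin n)).sup fun c => cycleMean A c

/-- A critical cycle: a cycle of the digraph `{(i, j) | a_{ij} > 0}`, of length at most `n`,
that attains the maximal cycle mean. -/
def IsCriticalCycle {n k : ℕ} (A : Matrix (Fin n) (Fin n) ℝ≥0) (c : Fin (k + 1) → Fin n) : Prop :=
  k + 1 ≤ n ∧ (∀ j, 0 < A (c j) (c (j + 1))) ∧ cycleMean A c = maxCycleMean A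

open Classical in
/-- The set `N_c` of critical nodes: the nodes lying on critical cycles. -/
def criticalNodes {n : ℕ} (A : Matrix (Fin n) (Fin n) ℝ≥0) : Finset (Fin n) :=
  Finset.univ.filter fun i => ∃ (k : ℕ) (c : Fin (k + 1) → Fin n), IsCriticalCycle A c ∧ ∃ j, c j = i

/-- The powers of `A` are bounded entrywise, that is, the max-series `I ⊕ A ⊕ A² ⊕ ⋯` converges. -/
def StarConverges {n : ℕ} (A : Matrix (Fin n) (Fin n) ℝ≥0) : Prop :=
  ∀ i j, BddAbove (Set.range fun m : ℕ => pow A m i j)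

/-- The Kleene star `A* = I ⊕ A ⊕ A² ⊕ ⋯` (meaningful when `StarConverges A`). -/
def star {n : ℕ} (A : Matrix (Fin n) (Fin n) ℝ≥0) : Matrix (Fin n) (Fin n) ℝ≥0 :=
  fun i j => ⨆ m : ℕ, pow A m i j

/-- `⊕_{m ≥ p} A^m` (meaningful when `StarConverges A`). -/
def tail {n : ℕ} (A : Matrix (Fin n) (Fin n) ℝ≥0) (p : ℕ) : Matrix (Fin n) (Fin n) ℝ≥0 :=
  fun i j => ⨆ m : Set.Ici p, pow A m i j

/-- `⊕_{i ∈ N_c} A*_{·i} A*_{i·}`: the max-sum over critical nodes of column times row of `A*`. -/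
def criticalSum {n : ℕ} (A : Matrix (Fin n) (Fin n) ℝ≥0) : Matrix (Fin n) (Fin n) ℝ≥0 :=
  fun k l => (criticalNodes A).sup fun i => star A k i * star A i l

/-- `Q` is a projector on `K`: its image is `K` and `Q² = Q`. -/
def IsProjectorOn {n : ℕ} (Q : Matrix (Fin n) (Fin n) ℝ≥0) (K : Set (Fin n → ℝ≥0)) : Prop :=
  Set.range (mulVec Q) = K ∧ mul Q Q = Q

/-- `Q` is a spectral projector for `A` on `V(A, α)`: a projector on `V(A, α)` commuting
with `A`. -/
def IsSpectralProjector {n : ℕ} (A : Matrix (Fin n) (Fin n) ℝ≥0) (α : ℝ≥0)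
    (Q : Matrix (Fin n) (Fin n) ℝ≥0) : Prop :=
  IsProjectorOn Q (eigencone A α) ∧ mul Q A = mul A Q

end

end MaxAlg

namespace MaxAlg

variable {n : ℕ}

local notation "Mat" => Matrix (Fin n) (Fin n) ℝ≥0

/-! The Perron root enters only through cycles: λ(A) = 1 forces maximal cycle mean 1. Following
maximizing indices of an eigenvector closes up a cycle of product 1 (`exists_cycleProd_eq_one`), and
conversely a positive maximal cycle mean is an eigenvalue (`maxCycleMean_mem_spectrum`). Cycle
products are then at most 1, so deleting closed sections from walks bounds all powers
(`pow_le_sup_range`).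

The tails decrease in `p`, hence converge entrywise to a limit L. Multiplication by A shifts the
tail index, so AL = LA = L; moreover L fixes whatever A fixes. Thus L is a spectral projector, and
any other one P satisfies P = PL = L (`eq_tailLimit`).

For the formula, a critical node carries a closed walk of weight at least 1, so a walk through it
can be lengthened without losing weight: each critical term lies below every tail. Conversely, a
walk either leaves some critical node or is a walk of B, the matrix A with critical rows erased
(`pow_le_criticalSum_sup`). The tails of B vanish in the limit, since a nonzero limit would give a
critical cycle avoiding critical nodes. -/

theorem mul_le_iff {A B : Mat} {i j : Fin n} {x : ℝ≥0} :
    mul A B i j ≤ x ↔ ∀ k, A i k * B k j ≤ x := by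
  simp [mul]

theorem mul_apply_le (A B : Mat) (i k j : Fin n) : A i k * B k j ≤ mul A B i j :=
  mul_le_iff.1 le_rfl k

theorem mulVec_le_iff {A : Mat} {v : Fin n → ℝ≥0} {i : Fin n} {x : ℝ≥0} :
    mulVec A v i ≤ x ↔ ∀ k, A i k * v k ≤ x := by
  simp [mulVec]

theorem mulVec_apply_le (A : Mat) (v : Fin n → ℝ≥0) (i k : Fin n) :
    A i k * v k ≤ mulVec A v i :=
  mulVec_le_iff.1 le_rfl k

theorem mulVec_mulVec (A B : Mat) (v : Fin n → ℝ≥0) :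
    mulVec A (mulVec B v) = mulVec (mul A B) v := by
  funext i
  simp only [mulVec, mul, NNReal.mul_finset_sup, NNReal.finset_sup_mul, mul_assoc]
  exact Finset.sup_comm _ _ _

theorem mul_assoc (A B C : Mat) : mul (mul A B) C = mul A (mul B C) := by
  funext i j
  exact (congrFun (mulVec_mulVec A B fun k => C k j) i).symm

theorem one_mul (A : Mat) : mul 1 A = A := by
  funext i j
  refine le_antisymm (mul_le_iff.2 fun k => ?_) ?_
  · by_cases h : i = k <;> simp [h, Matrix.one_apply]
  · simpa using mul_apply_le 1 A i i j

theorem mul_one (A : Mat) : mul A 1 = A := by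
  funext i j
  refine le_antisymm (mul_le_iff.2 fun k => ?_) ?_
  · by_cases h : k = j <;> simp [h, Matrix.one_apply]
  · simpa using mul_apply_le A 1 i j j

theorem one_mulVec (v : Fin n → ℝ≥0) : mulVec 1 v = v := by
  funext i
  exact congrFun (congrFun (one_mul (fun k _ => v k)) i) i

theorem pow_add (A : Mat) (a b : ℕ) : pow A (a + b) = mul (pow A a) (pow A b) := by
  induction b with
  | zero => simp [pow, mul_one]
  | succ b ih => rw [← Nat.add_assoc, pow, ih, mul_assoc, pow]

theorem pow_one (A : Mat) : pow A 1 = A := one_mul A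

theorem pow_succ' (A : Mat) (m : ℕ) : pow A (m + 1) = mul A (pow A m) := by
  rw [Nat.add_comm, pow_add, pow_one]

theorem pow_mul_pow_le (A : Mat) (a b : ℕ) (i k j : Fin n) :
    pow A a i k * pow A b k j ≤ pow A (a + b) i j := by
  rw [pow_add]
  exact mul_apply_le _ _ _ _ _

/-! ### Walks, closed walks and cycle means. -/

/-- The weight of the walk `p 0, …, p m`. -/
def walkWeight (A : Matrix (Fin n) (Fin n) ℝ≥0) (p : ℕ → Fin n) (m : ℕ) : ℝ≥0 :=
  ∏ t ∈ Finset.range m, A (p t) (p (t + 1))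

theorem walkWeight_add (A : Mat) (p : ℕ → Fin n) (a b : ℕ) :
    walkWeight A p (a + b) = walkWeight A p a * walkWeight A (fun t => p (a + t)) b := by
  simp [walkWeight, Finset.prod_range_add, Nat.add_assoc]

theorem walkWeight_le_pow (A : Mat) (p : ℕ → Fin n) (m : ℕ) :
    walkWeight A p m ≤ pow A m (p 0) (p m) := by
  induction m with
  | zero => simp [walkWeight, pow]
  | succ m ih =>
    rw [walkWeight, Finset.prod_range_succ]
    exact (mul_le_mul_left ih _).trans (mul_apply_le (pow A m) A _ (p m) _)

/-- Backtracking through maximizing indices recovers an optimal walk. A zero entry must be excluded: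
at length 0 no walk joins distinct nodes. -/
theorem exists_walkWeight_eq_pow (A : Mat) (m : ℕ) (i j : Fin n) (h : pow A m i j ≠ 0) :
    ∃ p : ℕ → Fin n, p 0 = i ∧ p m = j ∧ walkWeight A p m = pow A m i j := by
  induction m generalizing j with
  | zero =>
    have : i = j := by
      by_contra hij
      exact h (by simp [pow, hij])
    subst this
    exact ⟨fun _ => i, rfl, rfl, by simp [walkWeight, pow]⟩
  | succ m ih =>
    obtain ⟨k, -, hk⟩ := Finset.exists_mem_eq_sup Finset.univ ⟨i, Finset.mem_univ i⟩
      fun k => pow A m i k * A k j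
    have hk' : pow A (m + 1) i j = pow A m i k * A k j := hk
    obtain ⟨p, h0, hm, hp⟩ := ih k (left_ne_zero_of_mul (hk' ▸ h))
    refine ⟨fun t => if t ≤ m then p t else j, by simpa using h0, by simp, ?_⟩
    rw [hk', ← hp, walkWeight, Finset.prod_range_succ, walkWeight]
    congr 1
    · refine Finset.prod_congr rfl fun t ht => ?_
      have := Finset.mem_range.1 ht
      simp [this.le, Nat.succ_le_of_lt this]
    · simp [hm]

/-- The product of the entries along a closed sequence. -/
def cycleProd {k : ℕ} (A : Matrix (Fin n) (Fin n) ℝ≥0) (c : Fin (k + 1) → Fin n) : ℝ≥0 :=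
  ∏ j, A (c j) (c (j + 1))

theorem walkWeight_eq_cycleProd (A : Mat) {p : ℕ → Fin n} {k : ℕ} (h : p (k + 1) = p 0) :
    walkWeight A p (k + 1) = cycleProd A fun j : Fin (k + 1) => p j := by
  rw [walkWeight, Finset.prod_range, cycleProd]
  refine Finset.prod_congr rfl fun j _ => ?_
  rw [Fin.val_add_one]
  split_ifs with hj
  · simp [hj, h]
  · rfl

/-- The closed sequence may be rotated to start at any of its nodes without changing its product. -/
theorem cycleProd_le_pow {k : ℕ} (A : Mat) (c : Fin (k + 1) → Fin n) (j : Fin (k + 1)) :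
    cycleProd A c ≤ pow A (k + 1) (c j) (c j) := by
  have h := walkWeight_le_pow A (fun t => c (j + Fin.ofNat (k + 1) t)) (k + 1)
  have h0 : Fin.ofNat (k + 1) 0 = 0 := rfl
  have h1 : Fin.ofNat (k + 1) (k + 1) = 0 := by ext; simp
  simp only [h0, h1, add_zero] at h
  refine le_trans (le_of_eq ?_) h
  rw [walkWeight, Finset.prod_range, cycleProd, ← Equiv.prod_comp (Equiv.addLeft j)]
  refine Finset.prod_congr rfl fun t _ => ?_
  have h2 : Fin.ofNat (k + 1) t = t := by ext; simp
  have h3 : Fin.ofNat (k + 1) (t + 1) = t + 1 := by ext; simp [Fin.val_add]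
  simp only [h2, h3, Equiv.coe_addLeft, add_assoc]

theorem cycleMean_eq {k : ℕ} (A : Mat) (c : Fin (k + 1) → Fin n) :
    cycleMean A c = cycleProd A c ^ (1 / ((k : ℝ) + 1)) := rfl

theorem cycleMean_pow {k : ℕ} (A : Mat) (c : Fin (k + 1) → Fin n) :
    cycleMean A c ^ (k + 1) = cycleProd A c := by
  rw [cycleMean_eq, one_div, ← Nat.cast_succ]
  exact NNReal.rpow_inv_natCast_pow _ (Nat.succ_ne_zero k)

theorem cycleMean_le_maxCycleMean {k : ℕ} (A : Mat) (hk : k < n) (c : Fin (k + 1) → Fin n) :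
    cycleMean A c ≤ maxCycleMean A :=
  (Finset.le_sup (f := fun c => cycleMean A c) (Finset.mem_univ c)).trans
    (Finset.le_sup (f := fun k => (Finset.univ : Finset (Fin (k + 1) → Fin n)).sup
      fun c => cycleMean A c) (Finset.mem_range.2 hk))

theorem cycleProd_le {k : ℕ} (A : Mat) (hk : k < n) (c : Fin (k + 1) → Fin n) :
    cycleProd A c ≤ maxCycleMean A ^ (k + 1) := by
  rw [← cycleMean_pow]
  exact pow_le_pow_left' (cycleMean_le_maxCycleMean A hk c) _

/-- The nonvanishing excludes `n = 0`, where the maximum is over an empty family. -/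
theorem exists_cycleMean_eq (A : Mat) (h : maxCycleMean A ≠ 0) :
    ∃ k < n, ∃ c : Fin (k + 1) → Fin n, cycleMean A c = maxCycleMean A := by
  have hne : (Finset.range n).Nonempty := by
    by_contra hn
    rw [Finset.not_nonempty_iff_eq_empty] at hn
    exact h (by simp [maxCycleMean, hn])
  have hn : 0 < n := Finset.nonempty_range_iff.1 hne |> Nat.pos_of_ne_zero
  obtain ⟨k, hk, hk'⟩ := Finset.exists_mem_eq_sup _ hne fun k =>
    (Finset.univ : Finset (Fin (k + 1) → Fin n)).sup fun c => cycleMean A c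
  obtain ⟨c, -, hc⟩ := Finset.exists_mem_eq_sup (Finset.univ : Finset (Fin (k + 1) → Fin n))
    ⟨fun _ => ⟨0, hn⟩, Finset.mem_univ _⟩ fun c => cycleMean A c
  exact ⟨k, Finset.mem_range.1 hk, c, (hk'.trans hc).symm⟩

/-! ### Boundedness of the powers. -/

/-- Removing a closed section of weight at most `1` bounds all powers by the first `n`. -/
theorem pow_le_sup_range (A : Mat)
    (h : ∀ k < n, ∀ c : Fin (k + 1) → Fin n, cycleProd A c ≤ 1) (m : ℕ) (i j : Fin n) :
    pow A m i j ≤ (Finset.range n).sup fun k => pow A k i j := by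
  induction m using Nat.strong_induction_on with
  | _ m ih =>
    rcases lt_or_ge m n with hm | hm
    · exact Finset.le_sup (f := fun k => pow A k i j) (Finset.mem_range.2 hm)
    by_cases h0 : pow A m i j = 0
    · simp [h0]
    obtain ⟨p, rfl, rfl, hp⟩ := exists_walkWeight_eq_pow A m i j h0
    -- Pigeonhole on the first `n + 1` nodes only, so that the closed section has length at most `n`
    -- and falls under the hypothesis.
    obtain ⟨x, y, hxy, hpxy⟩ : ∃ x y : Fin (n + 1), x < y ∧ p x = p y := by
      obtain ⟨x, y, hne, he⟩ := Fintype.exists_ne_map_eq_of_card_lt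
        (fun x : Fin (n + 1) => p x) (by simp)
      rcases lt_or_gt_of_ne hne with hlt | hlt
      · exact ⟨x, y, hlt, he⟩
      · exact ⟨y, x, hlt, he.symm⟩
    obtain ⟨s, hs⟩ := x
    obtain ⟨t, ht⟩ := y
    simp only [Fin.mk_lt_mk] at hxy hpxy
    obtain ⟨d, rfl⟩ := Nat.exists_eq_add_of_lt hxy
    obtain ⟨r, rfl⟩ := Nat.exists_eq_add_of_le (show s + d + 1 ≤ m by omega)
    refine le_trans ?_ (ih (s + r) (by omega))
    have h1 : walkWeight A (fun t => p (s + t)) (d + 1) ≤ 1 := by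
      rw [walkWeight_eq_cycleProd A (by simpa [Nat.add_assoc] using hpxy.symm)]
      exact h d (by omega) _
    have h2 := walkWeight_le_pow A p s
    have h3 := walkWeight_le_pow A (fun t => p (s + d + 1 + t)) r
    rw [← hp, walkWeight_add, Nat.add_assoc s d 1, walkWeight_add, ← Nat.add_assoc s d 1]
    calc _ ≤ pow A s (p 0) (p s) * 1 * pow A r (p (s + d + 1)) (p (s + d + 1 + r)) := by
            gcongr
      _ ≤ _ := by
            rw [_root_.mul_one, ← hpxy]
            exact pow_mul_pow_le _ _ _ _ _ _

theorem starConverges_of_cycleProd_le_one (A : Mat)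
    (h : ∀ k < n, ∀ c : Fin (k + 1) → Fin n, cycleProd A c ≤ 1) : StarConverges A := by
  rintro i j
  exact ⟨_, Set.forall_mem_range.2 fun m => pow_le_sup_range A h m i j⟩

/-! ### Tails and their limit. -/

theorem StarConverges.bddAbove {A : Mat} (h : StarConverges A) (p : ℕ) (i j : Fin n) :
    BddAbove (Set.range fun m : Set.Ici p => pow A m i j) :=
  (h i j).mono (by rintro _ ⟨m, rfl⟩; exact ⟨m, rfl⟩)

/-- Convergence is essential here, as an unbounded supremum in `ℝ≥0` defaults to 0; upper bounds on
tails do not need it. -/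
theorem StarConverges.pow_le_tail {A : Mat} (h : StarConverges A) {p m : ℕ} (hm : p ≤ m)
    (i j : Fin n) : pow A m i j ≤ tail A p i j :=
  le_ciSup (h.bddAbove p i j) ⟨m, hm⟩

theorem tail_le {A : Mat} {p : ℕ} {i j : Fin n} {x : ℝ≥0} (h : ∀ m ≥ p, pow A m i j ≤ x) :
    tail A p i j ≤ x :=
  ciSup_le' fun m => h m m.2

theorem StarConverges.pow_le_star {A : Mat} (h : StarConverges A) (m : ℕ) (i j : Fin n) :
    pow A m i j ≤ star A i j :=
  le_ciSup (h i j) m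

theorem StarConverges.tail_antitone {A : Mat} (h : StarConverges A) (i j : Fin n) :
    Antitone fun p => tail A p i j :=
  fun _ _ hpq => tail_le fun _ hm => h.pow_le_tail (hpq.trans hm) _ _

theorem mul_tail_le {A : Mat} {p : ℕ} {i j : Fin n} {a x : ℝ≥0}
    (h : ∀ m ≥ p, a * pow A m i j ≤ x) : a * tail A p i j ≤ x :=
  NNReal.mul_iSup_le fun m => h m m.2

theorem tail_mul_le {A : Mat} {p : ℕ} {i j : Fin n} {a x : ℝ≥0}
    (h : ∀ m ≥ p, pow A m i j * a ≤ x) : tail A p i j * a ≤ x :=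
  NNReal.iSup_mul_le fun m => h m m.2

theorem StarConverges.mul_tail {A : Mat} (h : StarConverges A) (p : ℕ) :
    mul A (tail A p) = tail A (p + 1) := by
  funext i j
  refine le_antisymm (mul_le_iff.2 fun k => mul_tail_le fun m hm => ?_) (tail_le fun m hm => ?_)
  · refine (mul_apply_le A (pow A m) i k j).trans ?_
    rw [← pow_succ']
    exact h.pow_le_tail (Nat.succ_le_succ hm) _ _
  · obtain ⟨m, rfl⟩ := Nat.exists_eq_succ_of_ne_zero (Nat.ne_zero_of_lt hm)
    rw [Nat.succ_eq_add_one, pow_succ']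
    exact mul_le_iff.2 fun k => (mul_le_mul_right (h.pow_le_tail (Nat.le_of_succ_le_succ hm) _ _) _).trans
      (mul_apply_le A (tail A p) i k j)

theorem StarConverges.tail_mul {A : Mat} (h : StarConverges A) (p : ℕ) :
    mul (tail A p) A = tail A (p + 1) := by
  funext i j
  refine le_antisymm (mul_le_iff.2 fun k => tail_mul_le fun m hm => ?_) (tail_le fun m hm => ?_)
  · exact (mul_apply_le (pow A m) A i k j).trans (h.pow_le_tail (Nat.succ_le_succ hm) _ _)
  · obtain ⟨m, rfl⟩ := Nat.exists_eq_succ_of_ne_zero (Nat.ne_zero_of_lt hm)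
    exact mul_le_iff.2 fun k => (mul_le_mul_left (h.pow_le_tail (Nat.le_of_succ_le_succ hm) _ _) _).trans
      (mul_apply_le (tail A p) A i k j)

/-- Every power satisfies `P A^m = P`, so a maximum of such products is again `P`. The identity
holds for every `p` and therefore survives the limit. -/
theorem StarConverges.mul_tail_eq_self {A P : Mat} (h : StarConverges A) (hP : mul P A = P)
    (p : ℕ) : mul P (tail A p) = P := by
  have hpow : ∀ m, mul P (pow A m) = P := fun m => by
    induction m with
    | zero => exact mul_one P
    | succ m ih => rw [pow, ← mul_assoc, ih, hP]
  funext i j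
  refine le_antisymm (mul_le_iff.2 fun k => mul_tail_le fun m _ => ?_) ?_
  · conv_rhs => rw [← hpow m]
    exact mul_apply_le P (pow A m) i k j
  · conv_lhs => rw [← hpow p]
    exact mul_le_iff.2 fun k => (mul_le_mul_right (h.pow_le_tail le_rfl _ _) _).trans
      (mul_apply_le P (tail A p) i k j)

theorem StarConverges.tail_mulVec_eq_self {A : Mat} (h : StarConverges A) {v : Fin n → ℝ≥0}
    (hv : mulVec A v = v) (p : ℕ) : mulVec (tail A p) v = v := by
  have hpow : ∀ m, mulVec (pow A m) v = v := fun m => by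
    induction m with
    | zero => exact one_mulVec v
    | succ m ih => rw [pow, ← mulVec_mulVec, hv, ih]
  funext i
  refine le_antisymm (mulVec_le_iff.2 fun k => tail_mul_le fun m _ => ?_) ?_
  · conv_rhs => rw [← hpow m]
    exact mulVec_apply_le (pow A m) v i k
  · conv_lhs => rw [← hpow p]
    exact mulVec_le_iff.2 fun k => (mul_le_mul_left (h.pow_le_tail le_rfl _ _) _).trans
      (mulVec_apply_le (tail A p) v i k)

/-- The entrywise limit of the tails `⊕_{m ≥ p} A^m`. -/
noncomputable def tailLimit (A : Matrix (Fin n) (Fin n) ℝ≥0) : Matrix (Fin n) (Fin n) ℝ≥0 :=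
  fun i j => ⨅ p, tail A p i j

theorem StarConverges.tendsto_tail {A : Mat} (h : StarConverges A) :
    Tendsto (tail A) atTop (𝓝 (tailLimit A)) :=
  tendsto_pi_nhds.2 fun i => tendsto_pi_nhds.2 fun j =>
    tendsto_atTop_ciInf (h.tail_antitone i j) (OrderBot.bddBelow _)

theorem StarConverges.tendsto_tail_apply {A : Mat} (h : StarConverges A) (i j : Fin n) :
    Tendsto (fun p => tail A p i j) atTop (𝓝 (tailLimit A i j)) :=
  tendsto_pi_nhds.1 (tendsto_pi_nhds.1 h.tendsto_tail i) j

theorem continuous_mul_left (A : Mat) : Continuous fun B : Mat => mul A B :=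
  continuous_pi fun _ => continuous_pi fun j => Continuous.finset_sup_apply fun k _ =>
    continuous_const.mul (continuous_apply_apply k j)

theorem continuous_mul_right (B : Mat) : Continuous fun A : Mat => mul A B :=
  continuous_pi fun i => continuous_pi fun _ => Continuous.finset_sup_apply fun k _ =>
    (continuous_apply_apply i k).mul continuous_const

theorem continuous_mulVec_left (v : Fin n → ℝ≥0) : Continuous fun A : Mat => mulVec A v :=
  continuous_pi fun i => Continuous.finset_sup_apply fun k _ =>
    (continuous_apply_apply i k).mul continuous_const

theorem StarConverges.mul_tailLimit {A : Mat} (h : StarConverges A) :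
    mul A (tailLimit A) = tailLimit A :=
  tendsto_nhds_unique ((((continuous_mul_left A).tendsto _).comp h.tendsto_tail).congr h.mul_tail)
    ((tendsto_add_atTop_iff_nat 1).2 h.tendsto_tail)

theorem StarConverges.tailLimit_mul {A : Mat} (h : StarConverges A) :
    mul (tailLimit A) A = tailLimit A :=
  tendsto_nhds_unique ((((continuous_mul_right A).tendsto _).comp h.tendsto_tail).congr h.tail_mul)
    ((tendsto_add_atTop_iff_nat 1).2 h.tendsto_tail)

theorem StarConverges.mul_tailLimit_eq_self {A P : Mat} (h : StarConverges A)
    (hP : mul P A = P) : mul P (tailLimit A) = P :=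
  tendsto_nhds_unique (((continuous_mul_left P).tendsto _).comp h.tendsto_tail)
    (tendsto_const_nhds.congr fun p => (h.mul_tail_eq_self hP p).symm)

theorem StarConverges.tailLimit_mulVec_eq_self {A : Mat} (h : StarConverges A)
    {v : Fin n → ℝ≥0} (hv : mulVec A v = v) : mulVec (tailLimit A) v = v :=
  tendsto_nhds_unique (((continuous_mulVec_left v).tendsto _).comp h.tendsto_tail)
    (tendsto_const_nhds.congr fun p => (h.tail_mulVec_eq_self hv p).symm)

theorem mem_eigencone_one {A : Mat} {v : Fin n → ℝ≥0} : v ∈ eigencone A 1 ↔ mulVec A v = v := by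
  simp [eigencone]

theorem mul_eq_right_iff {A B : Mat} : mul A B = B ↔ ∀ j, mulVec A (fun k => B k j) = fun k => B k j :=
  ⟨fun h j => funext fun i => congrFun (congrFun h i) j,
    fun h => funext fun i => funext fun j => congrFun (h j) i⟩

/-! ### Existence and uniqueness of the spectral projector. -/

theorem StarConverges.isSpectralProjector_tailLimit {A : Mat} (h : StarConverges A) :
    IsSpectralProjector A 1 (tailLimit A) := by
  refine ⟨⟨Set.Subset.antisymm ?_ fun v hv => ⟨v, ?_⟩, h.mul_tailLimit_eq_self h.tailLimit_mul⟩,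
    h.tailLimit_mul.trans h.mul_tailLimit.symm⟩
  · rintro _ ⟨x, rfl⟩
    rw [mem_eigencone_one, mulVec_mulVec, h.mul_tailLimit]
  · exact h.tailLimit_mulVec_eq_self (mem_eigencone_one.1 hv)

theorem mulVec_single_one (P : Mat) (j : Fin n) :
    mulVec P (Pi.single j 1) = fun k => P k j := by
  funext i
  refine le_antisymm (mulVec_le_iff.2 fun k => ?_) ?_
  · by_cases hk : k = j
    · subst hk; simp
    · simp [hk]
  · simpa using mulVec_apply_le P (Pi.single j 1) i j

theorem StarConverges.eq_tailLimit {A P : Mat} (h : StarConverges A)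
    (hP : IsSpectralProjector A 1 P) : P = tailLimit A := by
  obtain ⟨⟨hrange, hPP⟩, hcomm⟩ := hP
  -- The columns of `P` are images of unit vectors, hence lie in `V(A,1)`.
  have hAP : mul A P = P := mul_eq_right_iff.2 fun j => by
    rw [← mem_eigencone_one, ← hrange]
    exact ⟨_, mulVec_single_one P j⟩
  -- The columns of the limit lie in `V(A,1)`, the range of `P`, on which the idempotent `P` acts as
  -- the identity.
  have hPQ : mul P (tailLimit A) = tailLimit A := mul_eq_right_iff.2 fun j => by
    have : (fun k => tailLimit A k j) ∈ Set.range (mulVec P) := by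
      rw [hrange, mem_eigencone_one]
      exact mul_eq_right_iff.1 h.mul_tailLimit j
    obtain ⟨x, hx⟩ := this
    rw [← hx, mulVec_mulVec, hPP]
  rw [← h.mul_tailLimit_eq_self (hcomm.trans hAP), hPQ]

/-! ### Eigenvectors, cycles and the Perron root. -/

/-- Following maximizing indices of an eigenvector for the eigenvalue `1` produces a cycle. -/
theorem exists_cycleProd_eq_one {A : Mat} {v : Fin n → ℝ≥0} (hv : mulVec A v = v) (h0 : v ≠ 0) :
    ∃ k < n, ∃ c : Fin (k + 1) → Fin n, cycleProd A c = 1 := by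
  obtain ⟨i, hi⟩ := Function.ne_iff.1 h0
  have hmax : ∀ i, ∃ k, v i = A i k * v k := fun i => by
    obtain ⟨k, -, hk⟩ := Finset.exists_mem_eq_sup Finset.univ ⟨i, Finset.mem_univ i⟩
      fun k => A i k * v k
    exact ⟨k, (congrFun hv i).symm.trans hk⟩
  choose f hf using hmax
  have hwalk : ∀ i m, v i = walkWeight A (fun t => f^[t] i) m * v (f^[m] i) := fun i m => by
    induction m with
    | zero => simp [walkWeight]
    | succ m ih =>
      rw [ih, walkWeight, walkWeight, Finset.prod_range_succ, _root_.mul_assoc]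
      congr 1
      simp only [Function.iterate_succ_apply']
      exact hf _
  obtain ⟨x, y, hxy, he⟩ : ∃ x y : Fin (n + 1), x < y ∧ f^[x] i = f^[y] i := by
    obtain ⟨x, y, hne, he⟩ := Fintype.exists_ne_map_eq_of_card_lt
      (fun x : Fin (n + 1) => f^[x] i) (by simp)
    rcases lt_or_gt_of_ne hne with hlt | hlt
    · exact ⟨x, y, hlt, he⟩
    · exact ⟨y, x, hlt, he.symm⟩
  obtain ⟨s, hs⟩ := x
  obtain ⟨t, ht⟩ := y
  simp only [Fin.mk_lt_mk] at hxy he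
  obtain ⟨d, rfl⟩ := Nat.exists_eq_add_of_lt hxy
  have hclosed : f^[d + 1] (f^[s] i) = f^[s] i := by
    rw [← Function.iterate_add_apply, he, Nat.add_comm, Nat.add_assoc]
  -- Nonvanishing of `v` propagates along the walk, which allows cancelling it once the cycle
  -- closes.
  have hs0 : v (f^[s] i) ≠ 0 := right_ne_zero_of_mul (hwalk i s ▸ hi)
  refine ⟨d, by omega, fun j => f^[j] (f^[s] i), ?_⟩
  rw [← walkWeight_eq_cycleProd A (p := fun t => f^[t] (f^[s] i)) hclosed]
  have := hwalk (f^[s] i) (d + 1)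
  rw [hclosed] at this
  exact mul_right_cancel₀ hs0 (by rw [← this, _root_.one_mul])

theorem one_le_pow_mul {A : Mat} {i : Fin n} {k : ℕ} (h : 1 ≤ pow A k i i) (p : ℕ) :
    1 ≤ pow A (k * p) i i := by
  induction p with
  | zero => simp [pow]
  | succ p ih => exact (one_le_mul ih h).trans (pow_mul_pow_le A (k * p) k i i i)

/-- Inserting the closed walk at `i` `p` times loses no weight and makes the total length at least
`p`, so the product is below every tail. -/
theorem StarConverges.star_mul_star_le_tailLimit {A : Mat} (h : StarConverges A) {i : Fin n}
    {k : ℕ} (hi : 1 ≤ pow A (k + 1) i i) (j l : Fin n) :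
    star A j i * star A i l ≤ tailLimit A j l := by
  refine le_ciInf fun p => ?_
  refine NNReal.iSup_mul_le fun a => NNReal.mul_iSup_le fun b => ?_
  calc pow A a j i * pow A b i l
      ≤ pow A a j i * pow A ((k + 1) * p) i i * pow A b i l := by
        gcongr
        exact le_mul_of_one_le_right' (one_le_pow_mul hi p)
    _ ≤ pow A (a + (k + 1) * p) j i * pow A b i l := by
        gcongr
        exact pow_mul_pow_le _ _ _ _ _ _
    _ ≤ pow A (a + (k + 1) * p + b) j l := pow_mul_pow_le _ _ _ _ _ _
    _ ≤ tail A p j l := h.pow_le_tail (by nlinarith) _ _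

theorem StarConverges.one_le_star_self {A : Mat} (h : StarConverges A) (i : Fin n) :
    1 ≤ star A i i := by
  simpa [pow] using h.pow_le_star 0 i i

theorem StarConverges.star_mul_apply_le {A : Mat} (h : StarConverges A) (i k l : Fin n) :
    star A i k * A k l ≤ star A i l :=
  NNReal.iSup_mul_le fun m => (mul_apply_le (pow A m) A i k l).trans (h.pow_le_star (m + 1) i l)

theorem cycleProd_smul {k : ℕ} (r : ℝ≥0) (A : Mat) (c : Fin (k + 1) → Fin n) :
    cycleProd (r • A) c = r ^ (k + 1) * cycleProd A c := by
  simp [cycleProd, Finset.prod_mul_distrib]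

theorem smul_mulVec (r : ℝ≥0) (A : Mat) (v : Fin n → ℝ≥0) :
    mulVec (r • A) v = r • mulVec A v := by
  funext i
  simp [mulVec, NNReal.mul_finset_sup, _root_.mul_assoc]

/-- A positive maximal cycle mean is an eigenvalue. -/
theorem maxCycleMean_mem_spectrum {A : Mat} (h : maxCycleMean A ≠ 0) :
    maxCycleMean A ∈ spectrum A := by
  set r := maxCycleMean A with hr
  -- After scaling by `r⁻¹` all cycle products of length at most `n` are at most 1, with equality on
  -- an optimal cycle. The column of the limit at a node of that cycle has diagonal entry at least
  -- 1, so it is the required nonzero eigenvector.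
  have hB : StarConverges (r⁻¹ • A) := starConverges_of_cycleProd_le_one _ fun k hk c => by
    rw [cycleProd_smul, inv_pow]
    exact inv_mul_le_one_of_le₀ (cycleProd_le A hk c) zero_le
  obtain ⟨k, hk, c, hc⟩ := exists_cycleMean_eq A h
  have h1 : cycleProd (r⁻¹ • A) c = 1 := by
    rw [cycleProd_smul, ← cycleMean_pow, hc, ← mul_pow, inv_mul_cancel₀ h, one_pow]
  have h2 := hB.star_mul_star_le_tailLimit (h1 ▸ cycleProd_le_pow (r⁻¹ • A) c 0) (c 0) (c 0)
  have h3 : 1 ≤ tailLimit (r⁻¹ • A) (c 0) (c 0) :=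
    (one_le_mul (hB.one_le_star_self _) (hB.one_le_star_self _)).trans h2
  refine ⟨fun i => tailLimit (r⁻¹ • A) i (c 0), ?_, fun h0 => ?_⟩
  · have h4 := mul_eq_right_iff.1 hB.mul_tailLimit (c 0)
    rw [smul_mulVec] at h4
    change mulVec A _ = r • _
    conv_rhs => rw [← h4]
    exact (smul_inv_smul₀ h (mulVec A fun i => tailLimit (r⁻¹ • A) i (c 0))).symm
  · have := congrFun h0 (c 0)
    simp only [Pi.zero_apply] at this
    simp [this] at h3

theorem maxCycleMean_eq_one {A : Mat} (h : IsPerronRoot A 1) : maxCycleMean A = 1 := by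
  refine le_antisymm ?_ ?_
  · by_cases h0 : maxCycleMean A = 0
    · simp [h0]
    · exact h.2 (maxCycleMean_mem_spectrum h0)
  · obtain ⟨v, hv, hv0⟩ := h.1
    obtain ⟨k, hk, c, hc⟩ := exists_cycleProd_eq_one (mem_eigencone_one.1 hv) hv0
    have := cycleMean_le_maxCycleMean A hk c
    rwa [cycleMean_eq, hc, NNReal.one_rpow] at this

/-! ### The formula over critical nodes. -/

/-- The matrix `A` with the rows of its critical nodes replaced by zero. -/
noncomputable def noncriticalPart (A : Matrix (Fin n) (Fin n) ℝ≥0) :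
    Matrix (Fin n) (Fin n) ℝ≥0 :=
  fun i j => if i ∈ criticalNodes A then 0 else A i j

theorem noncriticalPart_le (A : Mat) (i j : Fin n) : noncriticalPart A i j ≤ A i j := by
  unfold noncriticalPart
  split_ifs <;> simp

theorem cycleProd_mono {k : ℕ} {A B : Mat} (h : ∀ i j, A i j ≤ B i j) (c : Fin (k + 1) → Fin n) :
    cycleProd A c ≤ cycleProd B c :=
  Finset.prod_le_prod' fun _ _ => h _ _

/-- A nonzero column of the limit would be fixed by the noncritical part and yield a cycle of
product 1 in it. That cycle is critical for `A`, yet a positive product forbids any of its nodes to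
have an erased row. -/
theorem tailLimit_noncriticalPart {A : Mat} (hA : maxCycleMean A = 1)
    (h : StarConverges (noncriticalPart A)) : tailLimit (noncriticalPart A) = 0 := by
  by_contra hne
  obtain ⟨i, hi⟩ := Function.ne_iff.1 hne
  obtain ⟨j, hj⟩ := Function.ne_iff.1 hi
  obtain ⟨k, hk, c, hc⟩ := exists_cycleProd_eq_one (mul_eq_right_iff.1 h.mul_tailLimit j)
    fun h0 => hj (congrFun h0 i)
  have hpos : ∀ t, noncriticalPart A (c t) (c (t + 1)) ≠ 0 := fun t => by
    have : cycleProd (noncriticalPart A) c ≠ 0 := by simp [hc]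
    exact Finset.prod_ne_zero_iff.1 this t (Finset.mem_univ t)
  have hle := cycleMean_le_maxCycleMean A hk c
  have hge : 1 ≤ cycleMean A c := by
    rw [cycleMean_eq]
    exact NNReal.one_le_rpow (hc ▸ cycleProd_mono (noncriticalPart_le A) c) (by positivity)
  have hcrit : c 0 ∈ criticalNodes A := by
    simp only [criticalNodes, Finset.mem_filter, Finset.mem_univ, true_and]
    exact ⟨k, c, ⟨hk, fun t => (pos_iff_ne_zero.2 (hpos t)).trans_le (noncriticalPart_le A _ _),
      le_antisymm hle (hA ▸ hge)⟩, 0, rfl⟩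
  exact hpos 0 (by simp [noncriticalPart, hcrit])

theorem star_mul_star_le_criticalSum {A : Mat} {i : Fin n} (hi : i ∈ criticalNodes A)
    (j l : Fin n) : star A j i * star A i l ≤ criticalSum A j l :=
  Finset.le_sup (f := fun i => star A j i * star A i l) hi

/-- Induction on the last step, from `k` to `l`. If `k` is critical, the walk splits there into two
factors bounded by `A*`. Otherwise row `k` is not erased, and the critical bound persists because
`A* A ≤ A*`. -/
theorem StarConverges.pow_le_criticalSum_sup {A : Mat} (h : StarConverges A) (m : ℕ)
    (j l : Fin n) : pow A m j l ≤ criticalSum A j l ⊔ pow (noncriticalPart A) m j l := by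
  induction m generalizing l with
  | zero => exact le_sup_right
  | succ m ih =>
    refine mul_le_iff.2 fun k => ?_
    by_cases hk : k ∈ criticalNodes A
    · refine le_sup_of_le_left (le_trans ?_ (star_mul_star_le_criticalSum hk j l))
      gcongr
      · exact h.pow_le_star m j k
      · simpa [pow_one] using h.pow_le_star 1 k l
    · refine (mul_le_mul_left (ih k) _).trans ?_
      rw [max_mul_of_nonneg _ _ zero_le]
      refine sup_le_sup ?_ ?_
      · rw [criticalSum, NNReal.finset_sup_mul]
        refine Finset.sup_le fun i hi => le_trans ?_ (star_mul_star_le_criticalSum hi j l)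
        rw [_root_.mul_assoc]
        exact mul_le_mul_right (h.star_mul_apply_le i k l) _
      · have : A k l = noncriticalPart A k l := by simp [noncriticalPart, hk]
        rw [this]
        exact mul_apply_le (pow (noncriticalPart A) m) _ j k l

theorem tailLimit_eq_criticalSum {A : Mat} (hA : maxCycleMean A = 1) (h : StarConverges A)
    (hB : StarConverges (noncriticalPart A)) : tailLimit A = criticalSum A := by
  funext j l
  refine le_antisymm ?_ (Finset.sup_le fun i hi => ?_)
  · have hlim : Tendsto (fun p => criticalSum A j l ⊔ tail (noncriticalPart A) p j l) atTop
        (𝓝 (criticalSum A j l ⊔ 0)) := by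
      refine tendsto_const_nhds.sup_nhds ?_
      have := hB.tendsto_tail_apply j l
      rwa [tailLimit_noncriticalPart hA hB] at this
    rw [sup_of_le_left zero_le] at hlim
    refine le_of_tendsto_of_tendsto' (h.tendsto_tail_apply j l) hlim fun p => tail_le fun m hm => ?_
    exact (h.pow_le_criticalSum_sup m j l).trans (sup_le_sup le_rfl (hB.pow_le_tail hm j l))
  · simp only [criticalNodes, Finset.mem_filter, Finset.mem_univ, true_and] at hi
    obtain ⟨k, c, ⟨-, -, hc⟩, t, rfl⟩ := hi
    refine h.star_mul_star_le_tailLimit (k := k) ?_ j l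
    refine le_trans (le_of_eq ?_) (cycleProd_le_pow A c t)
    rw [← cycleMean_pow, hc, hA, one_pow]

end MaxAlg

theorem propositionp (n : ℕ) (A : Matrix (Fin n) (Fin n) ℝ≥0)
    (hA : MaxAlg.IsPerronRoot A 1) :
    MaxAlg.StarConverges A ∧
    ∃ Q : Matrix (Fin n) (Fin n) ℝ≥0,
      MaxAlg.IsSpectralProjector A 1 Q ∧
      (∀ P : Matrix (Fin n) (Fin n) ℝ≥0, MaxAlg.IsSpectralProjector A 1 P → P = Q) ∧
      Q = MaxAlg.criticalSum A ∧
      Tendsto (MaxAlg.tail A) atTop (𝓝 Q) := by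
  have hmean := MaxAlg.maxCycleMean_eq_one hA
  have hle : ∀ k < n, ∀ c : Fin (k + 1) → Fin n, MaxAlg.cycleProd A c ≤ 1 := fun k hk c => by
    simpa [hmean] using MaxAlg.cycleProd_le A hk c
  have hstar := MaxAlg.starConverges_of_cycleProd_le_one A hle
  have hstar' := MaxAlg.starConverges_of_cycleProd_le_one (MaxAlg.noncriticalPart A)
    fun k hk c => (MaxAlg.cycleProd_mono (MaxAlg.noncriticalPart_le A) c).trans (hle k hk c)
  exact ⟨hstar, MaxAlg.tailLimit A, hstar.isSpectralProjector_tailLimit,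
    fun P hP => hstar.eq_tailLimit hP, MaxAlg.tailLimit_eq_criticalSum hmean hstar hstar',
    hstar.tendsto_tail⟩
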